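/- Let $\varphi$ be the Thue--Morse morphism $0\mapsto 01$, $1\mapsto 10$ on $\{0,1\}^*$, let $k\ge 0$ be an integer, let $\mathbf{y}\in\{0,1\}^{\mathbb N}$ be an arbitrary infinite binary word, and let $\mathbf{x}=\varphi^k(\mathbf{y})$. For words $u,w$, let $\binom{u}{w}$ be the number of occurrences of $w$ as a (scattered) subword of $u$. For $m\ge 1$, write $u\sim_m v$ if $\binom{u}{w}=\binom{v}{w}$ for all words $w$ of length at most $m$. A $\varphi^k$-factorization of a word $u$ (with respect to $\mathbf{y}$) is an expression $u=p\,\varphi^k(z)\,s$ with $z\in\{0,1\}^*$ for which there are letters $a,b\in\{0,1\}$ such that $p$ is a (possibly empty) proper suffix of $\varphi^k(a)$, $s$ is a (possibly empty) proper prefix of $\varphi^k(b)$, and the corresponding ancestor is a factor of $\mathbf{y}$; here the ancestor is $azb$, $zb$, $az$ or $z$ according to whether, respectively, $p$ and $s$ are both non-empty, only $p$ is empty, only $s$ is empty, or both are empty. Let $u$ and $v$ be factors of $\mathbf{x}$ of length at least $2^k-1$, with $\varphi^k$-factorizations $u=p_1\varphi^k(z)s_1$ and $v=p_2\varphi^k(z')s_2$.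 Then $$u\sim_{k+1}v \text{ and } u\ne v \quad\Longleftrightarrow\quad z\sim_1 z',\ z\neq z' \text{ and } (p_1,s_1)=(p_2,s_2).$$ -/

import Mathlib

/-- The images of the letters under the Thue--Morse morphism `φ : 0 ↦ 01, 1 ↦ 10`. -/
def tmLetter : Fin 2 → List (Fin 2)
  | 0 => [0, 1]
  | 1 => [1, 0]

/-- The Thue--Morse morphism `φ` on finite binary words. -/
def tm (w : List (Fin 2)) : List (Fin 2) := w.flatMap tmLetter

/-- The Thue--Morse morphism `φ` on infinite binary words: since `φ` replaces the letter `a` by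
`a` followed by its complement, the letter of `φ(y)` at position `2m` is `y m` and the letter at
position `2m + 1` is the complement of `y m`. -/
def tmInf (y : ℕ → Fin 2) : ℕ → Fin 2 :=
  fun n => if n % 2 = 0 then y (n / 2) else 1 - y (n / 2)

/-- The word `x i, x (i + 1), …, x (i + n - 1)`. -/
def window {A : Type*} (x : ℕ → A) (i n : ℕ) : List A := (List.range n).map fun j => x (i + j)

/-- `φ(y)` is the infinite word whose prefixes are the images of the prefixes of `y`. -/
theorem window_tmInf (y : ℕ → Fin 2) (n : ℕ) : window (tmInf y) 0 (2 * n) = tm (window y 0 n) := by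
  have key : ∀ a : Fin 2, tmLetter a = [a, 1 - a] := by decide
  induction n with
  | zero => rfl
  | succ n ih =>
    have h : (2 * n + 1) / 2 = n := by omega
    simp only [window, tm, zero_add] at ih ⊢
    rw [Nat.mul_succ, List.range_succ, List.range_succ, List.range_succ]
    simp only [List.map_append, List.flatMap_append, ih]
    simp [key, tmInf, h]

/-- `u` is a factor of the infinite word `x`, that is, `u ∈ L(x)`. -/
def IsFactorOf {A : Type*} (u : List A) (x : ℕ → A) : Prop := ∃ i n : ℕ, u = window x i n

/-- The binomial coefficient of the words `u` and `w`: the number of times `w` occurs as a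
(scattered) subword of `u`. The list `u.sublists'` has one entry for each set of positions
of `u`, namely the word read at these positions. -/
def wordBinom {A : Type*} [DecidableEq A] (u w : List A) : ℕ := u.sublists'.count w

/-- `u ∼_k v`: the `k`-binomial equivalence. -/
def BinomEquiv {A : Type*} [DecidableEq A] (k : ℕ) (u v : List A) : Prop :=
  ∀ w : List A, w.length ≤ k → wordBinom u w = wordBinom v w

/-- `p` is a proper suffix of `w` (possibly empty). -/
def IsProperSuffix {A : Type*} (p w : List A) : Prop := p <:+ w ∧ p ≠ w

/-- `s` is a proper prefix of `w` (possibly empty). -/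
def IsProperPrefix {A : Type*} (s w : List A) : Prop := s <+: w ∧ s ≠ w

/-- `(p, φ^j(z), s)` is a `φ^j`-factorization of `u` (with respect to `y`): `u = p φ^j(z) s`, where
`p` is a proper suffix of `φ^j(a)` and `s` is a proper prefix of `φ^j(b)` for letters `a`, `b` such
that the corresponding ancestor is a factor of `y`. The ancestor is `azb`, without its first letter
if `p` is empty and without its last letter if `s` is empty. -/
def IsTMFactorization (j : ℕ) (y : ℕ → Fin 2) (u p z s : List (Fin 2)) : Prop :=
  u = p ++ tm^[j] z ++ s ∧
    ∃ a b : Fin 2, IsProperSuffix p (tm^[j] [a]) ∧ IsProperPrefix s (tm^[j] [b]) ∧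
      IsFactorOf ((if p = [] then [] else [a]) ++ z ++ (if s = [] then [] else [b])) y

/-! ### Binomial coefficients of words -/

section WordBinom

variable {A : Type*} [DecidableEq A]

/-! For the backward direction, `φ^k(0) ∼_k φ^k(1)`, and exchanging adjacent `k`-equivalent blocks
preserves `∼_{k+1}`; hence permuting the letters of `z` preserves the `(k+1)`-class of `φ^k(z)`.
Distinctness is injectivity of `φ`.

The forward direction is an induction on `k`. A `φ^{k+1}`-factorization refines to a
`φ^k`-factorization with inner word `w = α φ(z) β`, where `α` and `β` have at most one letter. By
induction the outer parts agree and cancel, leaving `φ^k(w) ∼_{k+2} φ^k(w')`. The invariant used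
next is `signPoly`, whose coefficients below `X^m` are fixed by the `∼_m` class. On it `φ` acts by
`f ↦ -X f(X(2+X))`, because `(1+X)^2 = 1 + X(2+X)` and `1 - (1+X) = -X`. So each `φ` costs exactly
one power of `X`, and `w`, `w'` share the coefficients of orders 0 and 1: the sums of `ε(wᵢ)` and of
`i ε(wᵢ)`. By `tm_factorization_congr`, these and the length determine `α`, `β` and the abelian
class of `z`, unless `w = w'`. -/

theorem wordBinom_nil_right (u : List A) : wordBinom u [] = 1 := by
  induction u with
  | nil => simp [wordBinom]
  | cons a u ih =>
    simp only [wordBinom, List.sublists'_cons, List.count_append] at ih ⊢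
    rw [ih, List.count_eq_zero_of_not_mem (by simp)]

theorem wordBinom_nil_cons (b : A) (w : List A) : wordBinom [] (b :: w) = 0 := by
  simp [wordBinom]

theorem wordBinom_cons_cons (a b : A) (u w : List A) :
    wordBinom (a :: u) (b :: w) = wordBinom u (b :: w) + if a = b then wordBinom u w else 0 := by
  simp only [wordBinom, List.sublists'_cons, List.count_append]
  congr 1
  split_ifs with h
  · subst h
    exact List.count_map_of_injective _ _ (List.cons_injective) _
  · refine List.count_eq_zero_of_not_mem ?_
    simp [h]

theorem wordBinom_append (u v w : List A) :
    wordBinom (u ++ v) w =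
      ∑ i ∈ Finset.range (w.length + 1), wordBinom u (w.take i) * wordBinom v (w.drop i) := by
  induction u generalizing w with
  | nil =>
    rw [Finset.sum_range_succ', Finset.sum_eq_zero]
    · simp [wordBinom_nil_right]
    · intro i hi
      cases w with
      | nil => simp at hi
      | cons b w => simp [wordBinom_nil_cons]
  | cons a u ih =>
    cases w with
    | nil => simp [wordBinom_nil_right]
    | cons b w =>
      rw [List.cons_append, wordBinom_cons_cons, ih, ih, List.length_cons,
        Finset.sum_range_succ' _ (w.length + 1), Finset.sum_range_succ' _ (w.length + 1)]
      simp only [List.take_succ_cons, List.drop_succ_cons, wordBinom_cons_cons, add_mul,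
        Finset.sum_add_distrib, List.take_zero, wordBinom_nil_right]
      split_ifs
      · ring
      · simp

theorem wordBinom_singleton (u : List A) (c : A) : wordBinom u [c] = u.count c := by
  induction u with
  | nil => simp [wordBinom_nil_cons]
  | cons a u ih => simp [wordBinom_cons_cons, ih, wordBinom_nil_right, List.count_cons]

theorem BinomEquiv.mono {k l : ℕ} {u v : List A} (h : BinomEquiv l u v) (hkl : k ≤ l) :
    BinomEquiv k u v := fun w hw => h w (hw.trans hkl)

theorem BinomEquiv.append {k : ℕ} {u v u' v' : List A} (h : BinomEquiv k u u')
    (h' : BinomEquiv k v v') : BinomEquiv k (u ++ v) (u' ++ v') := by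
  intro w hw
  rw [wordBinom_append, wordBinom_append]
  refine Finset.sum_congr rfl fun i _ => ?_
  rw [h _ (by simp; omega), h' _ (by simp; omega)]

/-- In the convolution formula the term `i = 0` is the coefficient sought; all others involve
strictly shorter words, so strong induction on the length cancels them. -/
theorem BinomEquiv.of_append_left {k : ℕ} {p u v : List A}
    (h : BinomEquiv k (p ++ u) (p ++ v)) : BinomEquiv k u v := by
  intro w
  induction hn : w.length using Nat.strong_induction_on generalizing w with
  | _ n ih =>
    intro hw
    have := h w (hn ▸ hw)
    rw [wordBinom_append, wordBinom_append, Finset.sum_range_succ', Finset.sum_range_succ'] at this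
    simp only [List.take_zero, wordBinom_nil_right, one_mul, List.drop_zero] at this
    rw [Finset.sum_congr rfl fun i hi => ?_] at this
    · exact Nat.add_left_cancel this
    · have hi := Finset.mem_range.1 hi
      rw [ih (w.length - (i + 1)) (by omega) (w.drop (i + 1)) List.length_drop (by omega)]

theorem BinomEquiv.of_append_right {k : ℕ} {s u v : List A}
    (h : BinomEquiv k (u ++ s) (v ++ s)) : BinomEquiv k u v := by
  intro w
  induction hn : w.length using Nat.strong_induction_on generalizing w with
  | _ n ih =>
    intro hw
    have := h w (hn ▸ hw)
    rw [wordBinom_append, wordBinom_append, Finset.sum_range_succ, Finset.sum_range_succ] at this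
    simp only [List.take_length, List.drop_length, wordBinom_nil_right, mul_one] at this
    rw [Finset.sum_congr rfl fun i hi => ?_] at this
    · exact Nat.add_left_cancel this
    · have hi := Finset.mem_range.1 hi
      rw [ih i (by omega) (w.take i) (by rw [List.length_take]; omega) (by omega)]

/-- Exchanging two `k`-binomially equivalent words gives `(k + 1)`-binomially equivalent words. -/
theorem BinomEquiv.append_comm {k : ℕ} {u v : List A} (h : BinomEquiv k u v) :
    BinomEquiv (k + 1) (u ++ v) (v ++ u) := by
  intro w hw
  rw [wordBinom_append, wordBinom_append]
  rcases Nat.eq_zero_or_pos w.length with h0 | h0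
  · rw [List.length_eq_zero_iff] at h0
    simp [h0, wordBinom_nil_right]
  obtain ⟨n, hn⟩ : ∃ n, w.length = n + 1 := ⟨w.length - 1, by omega⟩
  have hd : w.drop (n + 1) = [] := by simp [hn]
  have ht : w.take (n + 1) = w := List.take_of_length_le (by omega)
  -- The two extreme terms of the convolution, the only ones involving all of `w`, merely trade
  -- places; the middle ones involve words of length at most `k`.
  rw [hn, Finset.sum_range_succ, Finset.sum_range_succ', Finset.sum_range_succ _ (n + 1),
    Finset.sum_range_succ' _ n]
  simp only [hd, ht, List.take_zero, List.drop_zero, wordBinom_nil_right]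
  rw [Finset.sum_congr rfl fun i hi => ?_]
  · ring
  · have hi := Finset.mem_range.1 hi
    rw [h _ (by rw [List.length_take]; omega), h (w.drop (i + 1)) (by rw [List.length_drop]; omega)]

end WordBinom

theorem binomEquiv_one_iff_perm {u v : List (Fin 2)} : BinomEquiv 1 u v ↔ u.Perm v := by
  rw [List.perm_iff_count]
  constructor
  · intro h c
    rw [← wordBinom_singleton, ← wordBinom_singleton]
    exact h [c] (by simp)
  · intro h w hw
    match w, hw with
    | [], _ => rw [wordBinom_nil_right, wordBinom_nil_right]
    | [c], _ => rw [wordBinom_singleton, wordBinom_singleton, h]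

/-! ### The Thue–Morse morphism -/

theorem tm_append (u v : List (Fin 2)) : tm (u ++ v) = tm u ++ tm v := by simp [tm]

theorem tm_cons (a : Fin 2) (u : List (Fin 2)) : tm (a :: u) = a :: (1 - a) :: tm u := by
  have key : ∀ a : Fin 2, tmLetter a = [a, 1 - a] := by decide
  simp [tm, key]

theorem tm_nil : tm [] = [] := rfl

theorem length_tm (u : List (Fin 2)) : (tm u).length = 2 * u.length := by
  induction u with
  | nil => rfl
  | cons a u ih => simp [tm_cons, ih]; ring

theorem tm_injective : Function.Injective tm := by
  intro u
  induction u with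
  | nil => intro v h; cases v with
    | nil => rfl
    | cons b v => simp [tm_cons, tm_nil] at h
  | cons a u ih => intro v h; cases v with
    | nil => simp [tm_cons, tm_nil] at h
    | cons b v =>
      simp only [tm_cons, List.cons.injEq] at h
      rw [h.1, ih h.2.2]

theorem iterate_tm_append (k : ℕ) (u v : List (Fin 2)) :
    tm^[k] (u ++ v) = tm^[k] u ++ tm^[k] v := by
  induction k generalizing u v with
  | zero => rfl
  | succ k ih => simp only [Function.iterate_succ_apply, tm_append, ih]

theorem iterate_tm_nil (k : ℕ) : tm^[k] [] = [] :=
  Function.iterate_fixed rfl k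

theorem iterate_tm_succ_singleton (k : ℕ) (a : Fin 2) :
    tm^[k + 1] [a] = tm^[k] [a] ++ tm^[k] [1 - a] := by
  rw [Function.iterate_succ_apply, tm_cons, ← iterate_tm_append]
  rfl

theorem iterate_tm_singleton_ne_nil (k : ℕ) (a : Fin 2) : tm^[k] [a] ≠ [] := by
  intro h
  have := (tm_injective.iterate k) (h.trans (iterate_tm_nil k).symm)
  simp at this

theorem binomEquiv_iterate_tm_singleton (k : ℕ) (a b : Fin 2) :
    BinomEquiv k (tm^[k] [a]) (tm^[k] [b]) := by
  induction k generalizing a b with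
  | zero =>
    intro w hw
    rw [List.length_eq_zero_iff.1 (Nat.le_zero.1 hw), wordBinom_nil_right, wordBinom_nil_right]
  | succ k ih =>
    by_cases hab : a = b
    · exact hab ▸ fun w _ => rfl
    · have h : b = 1 - a ∧ a = 1 - b := by revert a b; decide
      rw [iterate_tm_succ_singleton, iterate_tm_succ_singleton, ← h.1, ← h.2]
      exact (ih a b).append_comm

theorem BinomEquiv.iterate_tm {z z' : List (Fin 2)} (h : BinomEquiv 1 z z') (k : ℕ) :
    BinomEquiv (k + 1) (tm^[k] z) (tm^[k] z') := by
  have cons (a : Fin 2) (u : List (Fin 2)) : tm^[k] (a :: u) = tm^[k] [a] ++ tm^[k] u :=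
    iterate_tm_append k [a] u
  induction binomEquiv_one_iff_perm.1 h with
  | nil => exact fun w _ => rfl
  | @cons a l₁ l₂ hp ih =>
    rw [cons a l₁, cons a l₂]
    exact BinomEquiv.append (fun w _ => rfl) (ih (binomEquiv_one_iff_perm.2 hp))
  | swap a b u =>
    rw [cons b (a :: u), cons a u, cons a (b :: u), cons b u, ← List.append_assoc, ← List.append_assoc]
    exact BinomEquiv.append (binomEquiv_iterate_tm_singleton k b a).append_comm (fun w _ => rfl)
  | trans hp hq ih ih' =>
    intro w hw
    exact (ih (binomEquiv_one_iff_perm.2 hp) w hw).trans (ih' (binomEquiv_one_iff_perm.2 hq) w hw)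

/-! ### The polynomial of signs of a binary word -/

open Polynomial in
/-- The polynomial `∑ i, ε(uᵢ) (1 + X) ^ i`, where `ε(0) = 1` and `ε(1) = -1`. -/
noncomputable def signPoly : List (Fin 2) → Polynomial ℤ
  | [] => 0
  | a :: u => C ((-1) ^ (a : ℕ)) + (1 + X) * signPoly u

/-- The list of all binary words of length `n`. -/
def binaryWords : ℕ → List (List (Fin 2))
  | 0 => [[]]
  | n + 1 => (binaryWords n).map (List.cons 0) ++ (binaryWords n).map (List.cons 1)

theorem length_of_mem_binaryWords {n : ℕ} {w : List (Fin 2)} (h : w ∈ binaryWords n) :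
    w.length = n := by
  induction n generalizing w with
  | zero => simpa [binaryWords] using h
  | succ n ih =>
    simp only [binaryWords, List.mem_append, List.mem_map] at h
    rcases h with ⟨w', h, rfl⟩ | ⟨w', h, rfl⟩ <;> simp [ih h]

/-- Pascal's rule: an occurrence either avoids the leading `a` or uses it, which forces the first
letter of `w`. -/
theorem sum_wordBinom_cons (n : ℕ) (a c : Fin 2) (u : List (Fin 2)) :
    ((binaryWords (n + 1)).map fun w => (wordBinom (a :: u) (w ++ [c]) : ℤ)).sum =
      ((binaryWords (n + 1)).map fun w => (wordBinom u (w ++ [c]) : ℤ)).sum +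
        ((binaryWords n).map fun w => (wordBinom u (w ++ [c]) : ℤ)).sum := by
  have h : (a = 0 ∧ ¬ a = 1) ∨ (a = 1 ∧ ¬ a = 0) := by revert a; decide
  simp only [binaryWords, List.map_append, List.map_map, List.sum_append, Function.comp_def,
    List.cons_append, wordBinom_cons_cons, Nat.cast_add, List.sum_map_add]
  rcases h with ⟨h, h'⟩ | ⟨h, h'⟩ <;> simp [h] <;> ring

open Polynomial in
-- The coefficient is the sum of `ε(uᵢ)` times `i` choose `n`: mark a position `i` and any `n`
-- positions before it, with no condition on their letters.
theorem coeff_signPoly (n : ℕ) (u : List (Fin 2)) :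
    (signPoly u).coeff n =
      ((binaryWords n).map fun w => (wordBinom u (w ++ [0]) : ℤ)).sum -
        ((binaryWords n).map fun w => (wordBinom u (w ++ [1]) : ℤ)).sum := by
  induction u generalizing n with
  | nil =>
    have h (w : List (Fin 2)) (c : Fin 2) : wordBinom [] (w ++ [c]) = 0 := by
      cases w <;> simp [wordBinom_nil_cons]
    simp [signPoly, h]
  | cons a u ih =>
    cases n with
    | zero =>
      have h := ih 0
      simp only [binaryWords, List.map_cons, List.map_nil, List.sum_singleton,
        List.nil_append] at h ⊢
      simp only [signPoly, coeff_add, coeff_C_zero, add_mul, one_mul, coeff_X_mul_zero, h,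
        wordBinom_cons_cons, wordBinom_nil_right]
      fin_cases a <;> simp <;> ring
    | succ n =>
      rw [sum_wordBinom_cons, sum_wordBinom_cons]
      simp only [signPoly, coeff_add, coeff_C_succ, add_mul, one_mul, coeff_X_mul, ih]
      ring

theorem BinomEquiv.pow_dvd_signPoly {k : ℕ} {u v : List (Fin 2)} (h : BinomEquiv k u v) :
    Polynomial.X ^ k ∣ signPoly u - signPoly v := by
  rw [Polynomial.X_pow_dvd_iff]
  intro n hn
  have key (c : Fin 2) : (binaryWords n).map (fun w => (wordBinom u (w ++ [c]) : ℤ)) =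
      (binaryWords n).map (fun w => (wordBinom v (w ++ [c]) : ℤ)) := by
    refine List.map_congr_left fun w hw => ?_
    rw [h _ (by simp [length_of_mem_binaryWords hw]; omega)]
  rw [Polynomial.coeff_sub, coeff_signPoly, coeff_signPoly, key, key, sub_self]

theorem neg_one_pow_one_sub (a : Fin 2) : ((-1) ^ ((1 - a : Fin 2) : ℕ) : ℤ) = -(-1) ^ (a : ℕ) := by
  revert a; decide

open Polynomial in
theorem signPoly_tm (u : List (Fin 2)) :
    signPoly (tm u) = -X * (signPoly u).comp (X * (2 + X)) := by
  induction u with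
  | nil => simp [signPoly, tm_nil]
  | cons a u ih =>
    simp only [tm_cons, signPoly, ih, neg_one_pow_one_sub, add_comp, mul_comp, C_comp, X_comp,
      one_comp, map_neg]
    ring

open Polynomial in
theorem pow_dvd_of_pow_dvd_comp {k : ℕ} {f : ℤ[X]} (h : X ^ k ∣ f.comp (X * (2 + X))) :
    X ^ k ∣ f := by
  induction k generalizing f with
  | zero => simp
  | succ k ih =>
    have h0 : f.coeff 0 = 0 := by
      have := X_dvd_iff.1 ((dvd_pow_self X k.succ_ne_zero).trans h)
      rwa [coeff_zero_eq_eval_zero, eval_comp, eval_mul, eval_X, zero_mul,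
        ← coeff_zero_eq_eval_zero] at this
    obtain ⟨g, rfl⟩ := X_dvd_iff.2 h0
    rw [mul_comp, X_comp, mul_assoc, pow_succ'] at h
    have h2 := (mul_dvd_mul_iff_left (X_ne_zero (R := ℤ))).1 h
    -- The constant term 2 is nonzero, so the prime `X` has multiplicity exactly one in `X(2+X)`.
    have hX : ¬ (X : ℤ[X]) ∣ 2 + X := by
      rw [X_dvd_iff]
      simp
    rw [pow_succ']
    exact mul_dvd_mul_left X (ih (prime_X.pow_dvd_of_dvd_mul_left k hX h2))

open Polynomial in
theorem pow_dvd_signPoly_of_iterate_tm {k m : ℕ} {z z' : List (Fin 2)}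
    (h : X ^ (m + k) ∣ signPoly (tm^[m] z) - signPoly (tm^[m] z')) :
    X ^ k ∣ signPoly z - signPoly z' := by
  induction m with
  | zero => simpa using h
  | succ m ih =>
    rw [Function.iterate_succ_apply', Function.iterate_succ_apply', signPoly_tm, signPoly_tm,
      ← mul_sub, ← sub_comp, Nat.add_right_comm, pow_succ', neg_mul, dvd_neg] at h
    exact ih (pow_dvd_of_pow_dvd_comp ((mul_dvd_mul_iff_left X_ne_zero).1 h))

/-! ### The first two moments of the signs -/

open Polynomial in
theorem coeff_zero_signPoly_cons (a : Fin 2) (u : List (Fin 2)) :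
    (signPoly (a :: u)).coeff 0 = (-1) ^ (a : ℕ) + (signPoly u).coeff 0 := by
  rw [signPoly, coeff_add, coeff_C_zero, add_mul, one_mul, coeff_add, coeff_X_mul_zero, add_zero]

open Polynomial in
theorem coeff_one_signPoly_cons (a : Fin 2) (u : List (Fin 2)) :
    (signPoly (a :: u)).coeff 1 = (signPoly u).coeff 1 + (signPoly u).coeff 0 := by
  have h : (C ((-1) ^ (a : ℕ)) : ℤ[X]).coeff 1 = 0 := coeff_C_succ
  have h' : (X * signPoly u).coeff 1 = (signPoly u).coeff 0 := coeff_X_mul _ 0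
  rw [signPoly, coeff_add, h, add_mul, one_mul, coeff_add, h', zero_add]

theorem coeff_zero_signPoly_concat (u : List (Fin 2)) (b : Fin 2) :
    (signPoly (u ++ [b])).coeff 0 = (signPoly u).coeff 0 + (-1) ^ (b : ℕ) := by
  induction u with
  | nil =>
    rw [List.nil_append, coeff_zero_signPoly_cons]
    simp [signPoly]
  | cons a u ih => rw [List.cons_append, coeff_zero_signPoly_cons, coeff_zero_signPoly_cons, ih]; ring

theorem coeff_one_signPoly_concat (u : List (Fin 2)) (b : Fin 2) :
    (signPoly (u ++ [b])).coeff 1 = (signPoly u).coeff 1 + u.length * (-1) ^ (b : ℕ) := by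
  induction u with
  | nil =>
    rw [List.nil_append, coeff_one_signPoly_cons]
    simp [signPoly]
  | cons a u ih =>
    rw [List.cons_append, coeff_one_signPoly_cons, coeff_one_signPoly_cons, ih,
      coeff_zero_signPoly_concat]
    push_cast [List.length_cons]
    ring

theorem coeff_zero_signPoly_tm (u : List (Fin 2)) : (signPoly (tm u)).coeff 0 = 0 := by
  induction u with
  | nil => simp [tm_nil, signPoly]
  | cons a u ih =>
    rw [tm_cons, coeff_zero_signPoly_cons, coeff_zero_signPoly_cons, ih, neg_one_pow_one_sub]
    ring

theorem coeff_one_signPoly_tm (u : List (Fin 2)) :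
    (signPoly (tm u)).coeff 1 = -(signPoly u).coeff 0 := by
  induction u with
  | nil => simp [tm_nil, signPoly]
  | cons a u ih =>
    rw [tm_cons, coeff_one_signPoly_cons, coeff_one_signPoly_cons, coeff_zero_signPoly_cons,
      coeff_zero_signPoly_cons, coeff_zero_signPoly_tm, ih, neg_one_pow_one_sub]
    ring

theorem abs_coeff_zero_signPoly_le (u : List (Fin 2)) : |(signPoly u).coeff 0| ≤ u.length := by
  induction u with
  | nil => simp [signPoly]
  | cons a u ih =>
    rw [coeff_zero_signPoly_cons]
    refine (abs_add_le _ _).trans ?_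
    rw [abs_neg_one_pow]
    push_cast [List.length_cons]
    linarith

/-- The equality case of the triangle inequality. -/
theorem eq_replicate_of_coeff_zero_signPoly {u : List (Fin 2)} {b : Fin 2}
    (h : (signPoly u).coeff 0 = u.length * (-1) ^ (b : ℕ)) : u = List.replicate u.length b := by
  induction u with
  | nil => rfl
  | cons a u ih =>
    rw [coeff_zero_signPoly_cons] at h
    push_cast [List.length_cons] at h
    have := abs_le.1 (abs_coeff_zero_signPoly_le u)
    have hab : a = b := by
      fin_cases a <;> fin_cases b <;> simp at h ⊢ <;> linarith [this.1, this.2]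
    subst hab
    rw [List.length_cons, List.replicate_succ, ← ih (by linarith)]

theorem coeff_zero_signPoly_eq_count (u : List (Fin 2)) :
    (signPoly u).coeff 0 = 2 * u.count 0 - u.length ∧
      (signPoly u).coeff 0 = u.length - 2 * u.count 1 := by
  induction u with
  | nil => simp [signPoly]
  | cons a u ih =>
    rw [coeff_zero_signPoly_cons]
    constructor
    · rw [ih.1]; fin_cases a <;> simp <;> ring
    · rw [ih.2]; fin_cases a <;> simp <;> ring

theorem binomEquiv_one_of_coeff_zero_signPoly {z z' : List (Fin 2)}
    (hlen : z.length = z'.length) (h : (signPoly z).coeff 0 = (signPoly z').coeff 0) :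
    BinomEquiv 1 z z' := by
  rw [binomEquiv_one_iff_perm, List.perm_iff_count]
  have h₁ := coeff_zero_signPoly_eq_count z
  have h₂ := coeff_zero_signPoly_eq_count z'
  intro c
  fin_cases c <;> simp <;> omega

theorem BinomEquiv.length_eq {k : ℕ} {u v : List (Fin 2)} (h : BinomEquiv (k + 1) u v) :
    u.length = v.length :=
  (binomEquiv_one_iff_perm.1 (h.mono (by omega))).length_eq

/-! ### Desubstitution -/

/-- Both sides are the alternating word of length `2n + 1` starting with `b`. Such words are how
factorizations of different shapes can coincide. -/
theorem tm_replicate_concat (n : ℕ) (b : Fin 2) :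
    tm (List.replicate n b) ++ [b] = b :: tm (List.replicate n (1 - b)) := by
  induction n with
  | zero => rfl
  | succ n ih =>
    rw [List.replicate_succ, List.replicate_succ, tm_cons, tm_cons, List.cons_append,
      List.cons_append, ih, sub_sub_cancel]

/-- With `S` the sum of signs and `n = |z|`, the moments give `ε(b) = -ε(a)` and `S(z') - S(z) =
(2n+1) ε(a)`. As `|z'| = n + 1`, this is the extreme value, so `z` and `z'` are constant and both
words alternate. -/
theorem cons_tm_concat_eq_tm {a b : Fin 2} {z z' : List (Fin 2)}
    (hlen : (a :: (tm z ++ [b])).length = (tm z').length)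
    (h₀ : (signPoly (a :: (tm z ++ [b]))).coeff 0 = (signPoly (tm z')).coeff 0)
    (h₁ : (signPoly (a :: (tm z ++ [b]))).coeff 1 = (signPoly (tm z')).coeff 1) :
    a :: (tm z ++ [b]) = tm z' := by
  simp only [List.length_cons, List.length_append, List.length_nil, length_tm] at hlen
  have hn : z'.length = z.length + 1 := by omega
  simp only [coeff_zero_signPoly_cons, coeff_one_signPoly_cons, coeff_zero_signPoly_concat,
    coeff_one_signPoly_concat, coeff_zero_signPoly_tm, coeff_one_signPoly_tm, length_tm] at h₀ h₁
  have hz := abs_le.1 (abs_coeff_zero_signPoly_le z)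
  have hz' := abs_le.1 (abs_coeff_zero_signPoly_le z')
  have hab : b = 1 - a := by
    revert h₀
    clear * -
    revert a b
    decide
  subst hab
  rw [neg_one_pow_one_sub] at h₁
  have e₁ : (signPoly z).coeff 0 = z.length * (-1) ^ ((1 - a : Fin 2) : ℕ) := by
    rw [neg_one_pow_one_sub]
    fin_cases a <;> simp at h₁ ⊢ <;> omega
  have e₂ : (signPoly z').coeff 0 = z'.length * (-1) ^ (a : ℕ) := by
    fin_cases a <;> simp at h₁ ⊢ <;> omega
  rw [eq_replicate_of_coeff_zero_signPoly e₁, eq_replicate_of_coeff_zero_signPoly e₂, hn,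
    tm_replicate_concat, List.replicate_succ, tm_cons, sub_sub_cancel]

theorem tm_concat_eq_cons_tm {a b : Fin 2} {z z' : List (Fin 2)}
    (hlen : (tm z ++ [b]).length = (a :: tm z').length)
    (h₀ : (signPoly (tm z ++ [b])).coeff 0 = (signPoly (a :: tm z')).coeff 0)
    (h₁ : (signPoly (tm z ++ [b])).coeff 1 = (signPoly (a :: tm z')).coeff 1) :
    tm z ++ [b] = a :: tm z' := by
  simp only [List.length_cons, List.length_append, List.length_nil, length_tm] at hlen
  have hn : z'.length = z.length := by omega
  simp only [coeff_zero_signPoly_cons, coeff_one_signPoly_cons, coeff_zero_signPoly_concat,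
    coeff_one_signPoly_concat, coeff_zero_signPoly_tm, coeff_one_signPoly_tm, length_tm] at h₀ h₁
  have hz := abs_le.1 (abs_coeff_zero_signPoly_le z)
  have hz' := abs_le.1 (abs_coeff_zero_signPoly_le z')
  have hab : a = b := by
    revert h₀
    clear * -
    revert a b
    decide
  subst hab
  have e₁ : (signPoly z).coeff 0 = z.length * (-1) ^ (a : ℕ) := by
    fin_cases a <;> simp at h₁ ⊢ <;> omega
  have e₂ : (signPoly z').coeff 0 = z'.length * (-1) ^ ((1 - a : Fin 2) : ℕ) := by
    rw [neg_one_pow_one_sub]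
    fin_cases a <;> simp at h₁ ⊢ <;> omega
  rw [eq_replicate_of_coeff_zero_signPoly e₁, eq_replicate_of_coeff_zero_signPoly e₂, hn,
    tm_replicate_concat]

/-- If `b ≠ b'`, the first moment forces `|S(z) - S(z')| = 2(2n+1)`, where `S` is the sum of signs
and `n` the common length; but the difference is at most `2n`. -/
theorem cons_tm_concat_congr {a b a' b' : Fin 2} {z z' : List (Fin 2)}
    (hlen : z.length = z'.length)
    (h₀ : (signPoly (a :: (tm z ++ [b]))).coeff 0 = (signPoly (a' :: (tm z' ++ [b']))).coeff 0)
    (h₁ : (signPoly (a :: (tm z ++ [b]))).coeff 1 = (signPoly (a' :: (tm z' ++ [b']))).coeff 1) :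
    a = a' ∧ b = b' ∧ BinomEquiv 1 z z' := by
  simp only [coeff_zero_signPoly_cons, coeff_one_signPoly_cons, coeff_zero_signPoly_concat,
    coeff_one_signPoly_concat, coeff_zero_signPoly_tm, coeff_one_signPoly_tm, length_tm] at h₀ h₁
  have hz := abs_le.1 (abs_coeff_zero_signPoly_le z)
  have hz' := abs_le.1 (abs_coeff_zero_signPoly_le z')
  have hb : b = b' := by
    by_contra hb
    have hb' : b' = 1 - b := by clear * - hb; revert b b'; decide
    subst hb'
    rw [neg_one_pow_one_sub] at h₁
    fin_cases b <;> simp at h₁ <;> omega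
  subst hb
  refine ⟨?_, rfl, binomEquiv_one_of_coeff_zero_signPoly hlen (by rw [hlen] at h₁; linarith)⟩
  have h : (-1 : ℤ) ^ (a : ℕ) = (-1) ^ (a' : ℕ) := by linarith
  revert h
  clear * -
  revert a a'
  decide

/-- Words with the same length and the same first two moments of the signs are equal or have the
same desubstitution up to the order of the letters. -/
theorem tm_factorization_congr {α β α' β' z z' : List (Fin 2)}
    (hα : α = [] ∨ ∃ a, α = [a]) (hβ : β = [] ∨ ∃ b, β = [b])
    (hα' : α' = [] ∨ ∃ a, α' = [a]) (hβ' : β' = [] ∨ ∃ b, β' = [b])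
    (hne : α ++ tm z ++ β ≠ α' ++ tm z' ++ β')
    (hlen : (α ++ tm z ++ β).length = (α' ++ tm z' ++ β').length)
    (h₀ : (signPoly (α ++ tm z ++ β)).coeff 0 = (signPoly (α' ++ tm z' ++ β')).coeff 0)
    (h₁ : (signPoly (α ++ tm z ++ β)).coeff 1 = (signPoly (α' ++ tm z' ++ β')).coeff 1) :
    α = α' ∧ β = β' ∧ BinomEquiv 1 z z' := by
  have hl := hlen
  simp only [List.length_append, length_tm] at hl
  -- Parity of the length eliminates half of the sixteen shapes.
  rcases hα with rfl | ⟨a, rfl⟩ <;> rcases hβ with rfl | ⟨b, rfl⟩ <;>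
    rcases hα' with rfl | ⟨a', rfl⟩ <;> rcases hβ' with rfl | ⟨b', rfl⟩ <;>
    simp only [List.length_cons, List.length_nil] at hl <;> (try omega) <;>
    simp only [List.nil_append, List.append_nil, List.cons_append] at hne hlen h₀ h₁
  · simp only [coeff_one_signPoly_tm, neg_inj] at h₁
    exact ⟨rfl, rfl, binomEquiv_one_of_coeff_zero_signPoly (by omega) h₁⟩
  · exact absurd (cons_tm_concat_eq_tm hlen.symm h₀.symm h₁.symm).symm hne
  · have hz : z.length = z'.length := by omega
    -- Prefixing the same dummy letter to both words keeps the moments equal and reduces to the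
    -- two-sided case.
    have h := cons_tm_concat_congr (a := 0) (a' := 0) (b := b) (b' := b') hz
      (by rw [coeff_zero_signPoly_cons, coeff_zero_signPoly_cons, h₀])
      (by rw [coeff_one_signPoly_cons, coeff_one_signPoly_cons, h₀, h₁])
    exact ⟨rfl, by rw [h.2.1], h.2.2⟩
  · exact absurd (tm_concat_eq_cons_tm hlen h₀ h₁) hne
  · exact absurd (tm_concat_eq_cons_tm hlen.symm h₀.symm h₁.symm).symm hne
  · have hz : z.length = z'.length := by omega
    have h := cons_tm_concat_congr (a := a) (a' := a') (b := 0) (b' := 0) hz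
      (by rw [← List.cons_append, ← List.cons_append, coeff_zero_signPoly_concat,
        coeff_zero_signPoly_concat, h₀])
      (by rw [← List.cons_append, ← List.cons_append, coeff_one_signPoly_concat,
        coeff_one_signPoly_concat, h₁, hlen])
    exact ⟨by rw [h.1], rfl, h.2.2⟩
  · exact absurd (cons_tm_concat_eq_tm hlen h₀ h₁) hne
  · have h := cons_tm_concat_congr (by omega) h₀ h₁
    exact ⟨by rw [h.1], by rw [h.2.1], h.2.2⟩

theorem exists_suffix_desubstitution {k : ℕ} {a : Fin 2} {p : List (Fin 2)}
    (hp : IsProperSuffix p (tm^[k + 1] [a])) :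
    ∃ (q α : List (Fin 2)) (c : Fin 2), p = q ++ tm^[k] α ∧ IsProperSuffix q (tm^[k] [c]) ∧
      (α = [] ∨ ∃ b, α = [b]) := by
  obtain ⟨⟨t, ht⟩, hne⟩ := hp
  rw [iterate_tm_succ_singleton] at ht hne
  rcases List.append_eq_append_iff.1 ht with ⟨q, h₁, h₂⟩ | ⟨q, h₁, h₂⟩
  · refine ⟨q, [1 - a], a, h₂, ⟨⟨t, h₁.symm⟩, ?_⟩, Or.inr ⟨_, rfl⟩⟩
    rintro rfl
    exact hne h₂
  -- If `p` is the whole block `φ^k(1 - a)`, it must go into `α`, since `q` has to be a proper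
  -- suffix.
  · by_cases hq : q = []
    · subst hq
      refine ⟨[], [1 - a], a, h₂.symm, ⟨List.nil_suffix, ?_⟩, Or.inr ⟨_, rfl⟩⟩
      exact (iterate_tm_singleton_ne_nil k a).symm
    · refine ⟨p, [], 1 - a, by rw [iterate_tm_nil, List.append_nil], ⟨⟨q, h₂.symm⟩, ?_⟩, Or.inl rfl⟩
      intro h
      rw [← h] at h₂
      exact hq (List.append_left_eq_self.1 h₂.symm)

theorem exists_prefix_desubstitution {k : ℕ} {a : Fin 2} {s : List (Fin 2)}
    (hs : IsProperPrefix s (tm^[k + 1] [a])) :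
    ∃ (q β : List (Fin 2)) (c : Fin 2), s = tm^[k] β ++ q ∧ IsProperPrefix q (tm^[k] [c]) ∧
      (β = [] ∨ ∃ b, β = [b]) := by
  obtain ⟨⟨t, ht⟩, hne⟩ := hs
  rw [iterate_tm_succ_singleton] at ht hne
  rcases List.append_eq_append_iff.1 ht with ⟨q, h₁, h₂⟩ | ⟨q, h₁, h₂⟩
  · by_cases hq : q = []
    · subst hq
      refine ⟨[], [a], a, by rw [h₁, List.append_nil, List.append_nil], ⟨List.nil_prefix, ?_⟩,
        Or.inr ⟨_, rfl⟩⟩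
      exact (iterate_tm_singleton_ne_nil k a).symm
    · refine ⟨s, [], a, by rw [iterate_tm_nil, List.nil_append], ⟨⟨q, h₁.symm⟩, ?_⟩, Or.inl rfl⟩
      intro h
      rw [← h] at h₁
      exact hq (List.append_right_eq_self.1 h₁.symm)
  · refine ⟨q, [a], 1 - a, h₁, ⟨⟨t, h₂.symm⟩, ?_⟩, Or.inr ⟨_, rfl⟩⟩
    rintro rfl
    exact hne h₁

/-- Two distinct `(k + 1)`-binomially equivalent words have `φ^k`-factorizations with the same
outer parts and abelian equivalent inner parts. -/
theorem BinomEquiv.factorization_congr {k : ℕ} {p z s p' z' s' : List (Fin 2)} {a b a' b' : Fin 2}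
    (hp : IsProperSuffix p (tm^[k] [a])) (hs : IsProperPrefix s (tm^[k] [b]))
    (hp' : IsProperSuffix p' (tm^[k] [a'])) (hs' : IsProperPrefix s' (tm^[k] [b']))
    (h : BinomEquiv (k + 1) (p ++ tm^[k] z ++ s) (p' ++ tm^[k] z' ++ s'))
    (hne : p ++ tm^[k] z ++ s ≠ p' ++ tm^[k] z' ++ s') :
    p = p' ∧ s = s' ∧ BinomEquiv 1 z z' := by
  induction k generalizing p z s p' z' s' a b a' b' with
  | zero =>
    have suffix_nil {q : List (Fin 2)} {c : Fin 2} (hq : IsProperSuffix q (tm^[0] [c])) :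
        q = [] := by
      rcases List.suffix_cons_iff.1 hq.1 with h | h
      · exact absurd h hq.2
      · exact List.suffix_nil.1 h
    have prefix_nil {q : List (Fin 2)} {c : Fin 2} (hq : IsProperPrefix q (tm^[0] [c])) :
        q = [] := by
      rcases List.prefix_cons_iff.1 hq.1 with h | ⟨t, h, ht⟩
      · exact h
      · rw [List.prefix_nil.1 ht] at h
        exact absurd h hq.2
    rw [suffix_nil hp, suffix_nil hp', prefix_nil hs, prefix_nil hs'] at h ⊢
    exact ⟨rfl, rfl, by simpa using h⟩
  | succ k ih =>
    obtain ⟨q, α, c, rfl, hq, hα⟩ := exists_suffix_desubstitution hp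
    obtain ⟨q', α', c', rfl, hq', hα'⟩ := exists_suffix_desubstitution hp'
    obtain ⟨r, β, d, rfl, hr, hβ⟩ := exists_prefix_desubstitution hs
    obtain ⟨r', β', d', rfl, hr', hβ'⟩ := exists_prefix_desubstitution hs'
    have key (q α z β r : List (Fin 2)) : q ++ tm^[k] α ++ tm^[k + 1] z ++ (tm^[k] β ++ r) =
        q ++ tm^[k] (α ++ tm z ++ β) ++ r := by
      simp only [iterate_tm_append, Function.iterate_succ_apply, List.append_assoc]
    rw [key, key] at h hne
    obtain ⟨rfl, rfl, -⟩ := ih hq hr hq' hr' (h.mono (by omega)) hne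
    have h' := h.of_append_right.of_append_left
    -- Of the `k + 2` powers of `X`, the `k` applications of `φ` absorb `k`; two remain, hence two
    -- moments.
    have hd := pow_dvd_signPoly_of_iterate_tm (k := 2) h'.pow_dvd_signPoly
    rw [Polynomial.X_pow_dvd_iff] at hd
    have hlen := (ih hq hr hq' hr' (h.mono (by omega)) hne).2.2.length_eq
    obtain ⟨rfl, rfl, hz⟩ := tm_factorization_congr hα hβ hα' hβ' (fun e => hne (by rw [e])) hlen
      (sub_eq_zero.1 (by simpa using hd 0 (by omega)))
      (sub_eq_zero.1 (by simpa using hd 1 (by omega)))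
    exact ⟨rfl, rfl, hz⟩

theorem mainTheorem7 (k : ℕ) (y : ℕ → Fin 2) (u v p₁ z s₁ p₂ z' s₂ : List (Fin 2))
    (hu : IsFactorOf u (tmInf^[k] y)) (hv : IsFactorOf v (tmInf^[k] y))
    (hu_len : 2 ^ k - 1 ≤ u.length) (hv_len : 2 ^ k - 1 ≤ v.length)
    (hu_fac : IsTMFactorization k y u p₁ z s₁) (hv_fac : IsTMFactorization k y v p₂ z' s₂) :
    (BinomEquiv (k + 1) u v ∧ u ≠ v) ↔
      (BinomEquiv 1 z z' ∧ z ≠ z' ∧ (p₁, s₁) = (p₂, s₂)) := by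
  obtain ⟨rfl, a, b, hp, hs, -⟩ := hu_fac
  obtain ⟨rfl, a', b', hp', hs', -⟩ := hv_fac
  constructor
  · rintro ⟨h, hne⟩
    obtain ⟨rfl, rfl, hz⟩ := h.factorization_congr hp hs hp' hs' hne
    exact ⟨hz, fun e => hne (by rw [e]), rfl⟩
  · rintro ⟨h, hne, e⟩
    obtain ⟨rfl, rfl⟩ := Prod.mk.inj e
    refine ⟨BinomEquiv.append (BinomEquiv.append (fun w _ => rfl) (h.iterate_tm k))
      (fun w _ => rfl), fun e => hne ?_⟩
    exact tm_injective.iterate k (List.append_cancel_left (List.append_cancel_right e))
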